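/- For $n\ge 1$, let $\mathrm{GRID}_n$ be the multigraph obtained from the $n\times n$ grid graph by adding one extra vertex, the sink, joined by two edges to each corner vertex and by one edge to each other boundary vertex of the grid (for $n=1$ the only vertex is a corner). The vertices other than the sink are called ordinary. A configuration is a map $c$ from the ordinary vertices to $\mathbb{N}=\{0,1,2,\dots\}$. An ordinary vertex $v$ is unstable in $c$ if $c(v)\ge\deg(v)$ (edges to the sink count in the degree); an unstable vertex may topple: it loses $\deg(v)$ particles, and every ordinary neighbour gains one particle for each edge joining it to $v$. A configuration is stable if it has no unstable vertex. A configuration $c_2$ is reachable from $c_1$ if some configuration $c_3\ge c_1$ (pointwise) can be transformed into $c_2$ by a finite, possibly empty, sequence of topplings of unstable vertices; $c$ is recurrent if it is reachable from every configuration, and transient otherwise. Start with the empty configuration $0$ and add particles one at a time at ordinary vertices of one's choice, relaxing to a stable configuration by topplings after each addition. The transience class $\mathrm{tcl}(\mathrm{GRID}_n)$ is the maximum number of particles that can be added in this way such that all the stable configurations obtained, the initial one included, are transient (and it is $0$ if $0$ itself is recurrent). **Theorem.** $\mathrm{tcl}(\mathrm{GRID}_n)=O(n^7)$. That is, there is a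 constant $C$ such that for every $n\ge 1$ the transience class $\mathrm{tcl}(\mathrm{GRID}_n)$ is finite and at most $C\,n^7$. -/

import Mathlib

/-- A sandpile with ordinary vertices `V`: a connected finite loopless multigraph on `Option V`,
whose distinguished vertex `none` is the sink. `mult u v` is the number of edges joining `u`
and `v`. -/
structure Sandpile (V : Type*) where
  mult : Option V → Option V → ℕ
  mult_symm : ∀ u v, mult u v = mult v u
  mult_self : ∀ u, mult u u = 0
  connected : (SimpleGraph.fromRel fun u v => 0 < mult u v).Connected

namespace Sandpile

variable {V : Type*} [Fintype V] (S : Sandpile V)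

/-- The degree of an ordinary vertex, edges to the sink included. -/
def degree (v : V) : ℕ := ∑ u : Option V, S.mult (some v) u

/-- A configuration `c : V → ℕ` is stable if no ordinary vertex holds as many particles as its
degree. -/
def Stable (c : V → ℕ) : Prop := ∀ v, c v < S.degree v

/-- `c'` arises from `c` by toppling the unstable vertex `v` once. -/
def TopplesAt (v : V) (c c' : V → ℕ) : Prop :=
  S.degree v ≤ c v ∧ c' v = c v - S.degree v ∧
    ∀ u, u ≠ v → c' u = c u + S.mult (some v) (some u)

/-- There is a (possibly empty) toppling sequence from `c` to `c'`. -/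
def TopplesTo : (V → ℕ) → (V → ℕ) → Prop :=
  Relation.ReflTransGen fun c c' => ∃ v, S.TopplesAt v c c'

/-- `c₂` is reachable from `c₁`: some `c₃ ≥ c₁` has a toppling sequence to `c₂`. -/
def Reachable (c₁ c₂ : V → ℕ) : Prop := ∃ c₃, c₁ ≤ c₃ ∧ S.TopplesTo c₃ c₂

/-- A configuration is recurrent if it is reachable from every configuration. -/
def Recurrent (c : V → ℕ) : Prop := ∀ c', S.Reachable c' c

/-- A configuration is transient if it is not recurrent. -/
def Transient (c : V → ℕ) : Prop := ¬ S.Recurrent c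

/-- `S.TransientRun t c`: starting with the empty configuration, one can add `t` particles, one at
a time at vertices of one's choice and relaxing to a stable configuration after each addition, so
that every configuration obtained (the initial and the final one included) is transient and the
final one is `c`. -/
inductive TransientRun [DecidableEq V] : ℕ → (V → ℕ) → Prop
  | empty : S.Transient 0 → TransientRun 0 0
  | add {t : ℕ} {c c' : V → ℕ} (v : V) : TransientRun t c →
      S.TopplesTo (c + Pi.single v 1) c' → S.Stable c' → S.Transient c' →
      TransientRun (t + 1) c'

/-- The transience class: the maximum number of particles that can be added to the empty sandpile
before reaching a recurrent configuration. It takes values in `ℕ∞`, hence is `⊤` if the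
number is unbounded. -/
noncomputable def tcl [DecidableEq V] : ℕ∞ := ⨆ (t : ℕ) (_ : ∃ c, S.TransientRun t c), (t : ℕ∞)

end Sandpile

/-- The `n × n` grid graph. -/
abbrev gridGraph (n : ℕ) : SimpleGraph (Fin n × Fin n) :=
  SimpleGraph.boxProd (SimpleGraph.pathGraph n) (SimpleGraph.pathGraph n)

/-- `i` is the first or the last index. -/
abbrev GridExtreme {n : ℕ} (i : Fin n) : Prop := (i : ℕ) = 0 ∨ (i : ℕ) + 1 = n

/-- The number of edges to the sink: two from a corner, one from any other boundary vertex. -/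
def gridSinkEdges {n : ℕ} (p : Fin n × Fin n) : ℕ :=
  if GridExtreme p.1 ∧ GridExtreme p.2 then 2
  else if GridExtreme p.1 ∨ GridExtreme p.2 then 1 else 0

open Classical in
/-- Edge multiplicities of the grid with a sink attached to its boundary. -/
noncomputable def gridMult (n : ℕ) : Option (Fin n × Fin n) → Option (Fin n × Fin n) → ℕ
  | some p, some q => if (gridGraph n).Adj p q then 1 else 0
  | some p, none => gridSinkEdges p
  | none, some p => gridSinkEdges p
  | none, none => 0

theorem gridMult_connected (n : ℕ) :
    (SimpleGraph.fromRel fun u v => 0 < gridMult n u v).Connected := by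
  rw [SimpleGraph.connected_iff_exists_forall_reachable]
  refine ⟨none, ?_⟩
  rintro (_ | ⟨i, j⟩)
  · exact SimpleGraph.Reachable.refl _
  · obtain ⟨m, rfl⟩ : ∃ m, n = m + 1 := ⟨n - 1, by have := i.2; omega⟩
    have hG : (gridGraph (m + 1)).Connected :=
      (SimpleGraph.pathGraph_connected m).boxProd (SimpleGraph.pathGraph_connected m)
    let f : gridGraph (m + 1) →g
        (SimpleGraph.fromRel fun u v => 0 < gridMult (m + 1) u v) :=
      { toFun := some
        map_rel' := by
          intro p q h
          rw [SimpleGraph.fromRel_adj]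
          refine ⟨fun e => h.ne (Option.some.inj e), Or.inl ?_⟩
          simp only [gridMult, if_pos h, Nat.one_pos] }
    have h1 := (hG.preconnected (0, 0) (i, j)).map f
    refine SimpleGraph.Reachable.trans (SimpleGraph.Adj.reachable ?_) h1
    rw [SimpleGraph.fromRel_adj]
    refine ⟨by simp [f], Or.inl ?_⟩
    change 0 < gridSinkEdges ((0, 0) : Fin (m + 1) × Fin (m + 1))
    simp [gridSinkEdges, GridExtreme]

/-- The sandpile `GRID_n`. -/
noncomputable def gridSandpile (n : ℕ) : Sandpile (Fin n × Fin n) where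
  mult := gridMult n
  mult_symm := by
    rintro (_ | p) (_ | q) <;> simp only [gridMult]
    by_cases h : (gridGraph n).Adj p q
    · rw [if_pos h, if_pos h.symm]
    · rw [if_neg h, if_neg fun h' => h h'.symm]
  mult_self := by
    rintro (_ | p) <;> simp [gridMult]
  connected := gridMult_connected n

/-!
If a transient run adds `x`, ends in `c` and has odometer `z` (the number of topplings at each
vertex), then `c + Δ z = x` with `Δ` the reduced Laplacian, and `z` vanishes at some vertex `v`:
otherwise every vertex has toppled, and the burning criterion makes `c` recurrent. Evaluating at `v`
against the Green function `G = Δ⁻¹` gives `∑ u, G v u * x u = ∑ u, G v u * c u`, so the number of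
particles is at most `∑ u, G v u * deg u` divided by the minimum of `G v`.

On the grid, for `v = (i, j)`, the numerator is at most `2 (i + 1) (n - i)`. For the denominator, a
discrete Harnack inequality bounds a nonnegative superharmonic function below by its value at the
centre. The minimum principle is applied twice: first on a disc, against the logarithm, which
controls the function on the two central axes at the cost of a factor `log n`; then on the four
quadrants cut out by the axes, against a product of tent functions. Using it in both variables of
`G` bounds `G v u` below, and the dependence on `v` in numerator and denominator largely cancels,
which gives `O(n ^ 5 log ^ 2 n)`.
-/

open scoped Matrix

namespace Sandpile

variable {V : Type*} [Fintype V] (S : Sandpile V)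

theorem sum_mult_le_degree (u : V) : ∑ w, S.mult (some u) (some w) ≤ S.degree u := by
  rw [degree, Fintype.sum_option]
  exact Nat.le_add_left _ _

section Laplacian

variable [DecidableEq V]

/-- The reduced Laplacian, that is the graph Laplacian with the row and the column of the sink
removed. Toppling `v` subtracts its `v`-th column from the configuration. -/
noncomputable def laplacian : Matrix V V ℝ :=
  Matrix.diagonal (fun u => (S.degree u : ℝ)) - Matrix.of fun u w => (S.mult (some u) (some w) : ℝ)

/-- The Green function of the sandpile, the inverse of the reduced Laplacian. Up to the factor
`S.degree u`, its entry at `v`, `u` is the expected number of visits to `u` of the simple random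
walk from `v` killed at the sink. -/
noncomputable def green : Matrix V V ℝ := S.laplacian⁻¹

/-- A function on the ordinary vertices, extended by `0` to the sink, is superharmonic if at each
ordinary vertex it is at least its average over the neighbours. -/
def Superharmonic (f : V → ℝ) : Prop := 0 ≤ S.laplacian *ᵥ f

theorem laplacian_apply (u w : V) :
    S.laplacian u w = (if u = w then (S.degree u : ℝ) else 0) - S.mult (some u) (some w) := by
  simp [laplacian, Matrix.diagonal_apply]

theorem laplacian_mulVec_apply (f : V → ℝ) (u : V) :
    (S.laplacian *ᵥ f) u = S.degree u * f u - ∑ w, (S.mult (some u) (some w) : ℝ) * f w := by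
  rw [laplacian, Matrix.sub_mulVec, Pi.sub_apply, Matrix.mulVec_diagonal]
  rfl

theorem laplacian_mulVec_eq_sum_option (f : V → ℝ) (u : V) :
    (S.laplacian *ᵥ f) u = ∑ o, (S.mult (some u) o : ℝ) * (f u - o.elim 0 f) := by
  simp only [laplacian_mulVec_apply, degree, mul_sub, Finset.sum_sub_distrib, ← Finset.sum_mul,
    Nat.cast_sum]
  simp [Fintype.sum_option]

theorem laplacian_transpose : S.laplacianᵀ = S.laplacian := by
  ext u w
  rw [Matrix.transpose_apply, laplacian_apply, laplacian_apply, S.mult_symm]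
  obtain rfl | h := eq_or_ne u w
  · rfl
  · rw [if_neg h, if_neg h.symm]

variable {S}

theorem nonneg_of_laplacian_mulVec_nonneg {D : Set V} {f : V → ℝ}
    (hD : ∀ u ∈ D, 0 ≤ (S.laplacian *ᵥ f) u) (hDc : ∀ u ∉ D, 0 ≤ f u) : 0 ≤ f := by
  let f₀ : Option V → ℝ := fun o => o.elim 0 f
  obtain ⟨a, ha⟩ := Finite.exists_min f₀
  by_contra hf
  obtain ⟨u₀, hu₀⟩ : ∃ u, f u < 0 := by simpa [Pi.le_def] using hf
  have ha_neg : f₀ a < 0 := (ha (some u₀)).trans_lt hu₀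
  have hspread : ∀ b c, 0 < S.mult b c → f₀ b = f₀ a → f₀ c = f₀ a := by
    rintro (_ | u) c hbc hb
    · exact absurd hb ha_neg.ne'
    have hu : u ∈ D := by
      by_contra hu
      exact (hDc u hu).not_gt (hb.trans_lt ha_neg)
    have hterm : ∀ o ∈ Finset.univ, (S.mult (some u) o : ℝ) * (f u - f₀ o) ≤ 0 := fun o _ =>
      mul_nonpos_of_nonneg_of_nonpos (Nat.cast_nonneg _) (sub_nonpos.2 (hb.trans_le (ha o)))
    have hsum : ∑ o, (S.mult (some u) o : ℝ) * (f u - f₀ o) = 0 :=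
      (Finset.sum_nonpos hterm).antisymm (S.laplacian_mulVec_eq_sum_option f u ▸ hD u hu)
    have hzero := (Finset.sum_eq_zero_iff_of_nonpos hterm).1 hsum c (Finset.mem_univ c)
    have hdiff := (mul_eq_zero.1 hzero).resolve_left (by exact_mod_cast hbc.ne')
    exact (sub_eq_zero.1 hdiff).symm.trans hb
  have hwalk : ∀ {b c} (_ : (SimpleGraph.fromRel fun b c => 0 < S.mult b c).Walk b c),
      f₀ b = f₀ a → f₀ c = f₀ a := by
    intro b c walk hb
    induction walk with
    | nil => exact hb
    | cons hadj _ ih =>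
      refine ih (hspread _ _ ?_ hb)
      rcases ((SimpleGraph.fromRel_adj _ _ _).1 hadj).2 with h | h
      · exact h
      · rwa [S.mult_symm]
  obtain ⟨walk⟩ := S.connected.preconnected a none
  exact (hwalk walk rfl).not_gt ha_neg

theorem Superharmonic.nonneg {f : V → ℝ} (hf : S.Superharmonic f) : 0 ≤ f :=
  nonneg_of_laplacian_mulVec_nonneg (D := Set.univ) (fun u _ => hf u)
    fun u hu => absurd (Set.mem_univ u) hu

variable (S)

theorem isUnit_laplacian : IsUnit S.laplacian := by
  refine Matrix.mulVec_injective_iff_isUnit.1 fun f g hfg => ?_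
  have hle : ∀ {f g : V → ℝ}, S.laplacian *ᵥ f = S.laplacian *ᵥ g → g ≤ f := by
    intro f g h
    have hsub : S.Superharmonic (f - g) := by rw [Superharmonic, Matrix.mulVec_sub, h, sub_self]
    exact sub_nonneg.1 hsub.nonneg
  exact le_antisymm (hle hfg.symm) (hle hfg)

theorem laplacian_mul_green : S.laplacian * S.green = 1 :=
  Matrix.mul_nonsing_inv _ ((Matrix.isUnit_iff_isUnit_det _).1 S.isUnit_laplacian)

theorem green_mul_laplacian : S.green * S.laplacian = 1 :=
  Matrix.nonsing_inv_mul _ ((Matrix.isUnit_iff_isUnit_det _).1 S.isUnit_laplacian)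

theorem green_comm (u v : V) : S.green u v = S.green v u := by
  rw [← Matrix.transpose_apply S.green, green, Matrix.transpose_nonsing_inv, laplacian_transpose]

theorem laplacian_mulVec_green (v : V) : S.laplacian *ᵥ S.green v = Pi.single v 1 := by
  have hcol : S.green v = S.green *ᵥ Pi.single v 1 := by
    ext u
    rw [Matrix.mulVec_single_one, Matrix.col_apply, green_comm]
  rw [hcol, Matrix.mulVec_mulVec, laplacian_mul_green, Matrix.one_mulVec]

theorem superharmonic_green (v : V) : S.Superharmonic (S.green v) := by
  rw [Superharmonic, laplacian_mulVec_green]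
  exact Pi.single_nonneg.2 zero_le_one

theorem green_nonneg (v u : V) : 0 ≤ S.green v u :=
  (S.superharmonic_green v).nonneg u

theorem one_le_degree_mul_green_self (v : V) : 1 ≤ S.degree v * S.green v v := by
  have h := congrFun (S.laplacian_mulVec_green v) v
  rw [laplacian_mulVec_apply, Pi.single_eq_same] at h
  have : 0 ≤ ∑ w, (S.mult (some v) (some w) : ℝ) * S.green v w :=
    Finset.sum_nonneg fun w _ => mul_nonneg (Nat.cast_nonneg _) (S.green_nonneg v w)
  linarith

theorem sum_green_mul_laplacian_mulVec (f : V → ℝ) (v : V) :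
    ∑ u, S.green v u * (S.laplacian *ᵥ f) u = f v := by
  change (S.green *ᵥ (S.laplacian *ᵥ f)) v = f v
  rw [Matrix.mulVec_mulVec, green_mul_laplacian, Matrix.one_mulVec]

variable {S}

theorem Superharmonic.mult_mul_le_degree_mul {f : V → ℝ} (hf : S.Superharmonic f) (u w : V) :
    S.mult (some u) (some w) * f w ≤ S.degree u * f u := by
  have hfu := hf u
  rw [Pi.zero_apply, laplacian_mulVec_apply] at hfu
  exact (Finset.single_le_sum (f := fun y => (S.mult (some u) (some y) : ℝ) * f y)
    (fun y _ => mul_nonneg (Nat.cast_nonneg _) (hf.nonneg y))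
    (Finset.mem_univ w)).trans (sub_nonneg.1 hfu)

variable (S)

theorem exists_nat_le_laplacian_mulVec (k : V → ℕ) :
    ∃ w : V → ℕ, ∀ u, (k u : ℝ) ≤ (S.laplacian *ᵥ fun y => (w y : ℝ)) u := by
  -- Rounding a real solution up decreases its Laplacian by at most the degree.
  let g : V → ℝ := S.green *ᵥ fun u => (k u + S.degree u : ℝ)
  have hg : S.laplacian *ᵥ g = fun u => (k u + S.degree u : ℝ) := by
    rw [Matrix.mulVec_mulVec, laplacian_mul_green, Matrix.one_mulVec]
  have hsuper : S.Superharmonic g := by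
    rw [Superharmonic, hg]
    exact fun u => by positivity
  refine ⟨fun u => ⌈g u⌉₊, fun u => ?_⟩
  have hgu := congrFun hg u
  rw [laplacian_mulVec_apply] at hgu ⊢
  have hdiag : S.degree u * g u ≤ S.degree u * (⌈g u⌉₊ : ℝ) :=
    mul_le_mul_of_nonneg_left (Nat.le_ceil _) (Nat.cast_nonneg _)
  have hoff : ∑ w, (S.mult (some u) (some w) : ℝ) * ⌈g w⌉₊ ≤
      ∑ w, (S.mult (some u) (some w) : ℝ) * g w + S.degree u := by
    calc ∑ w, (S.mult (some u) (some w) : ℝ) * ⌈g w⌉₊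
        ≤ ∑ w, (S.mult (some u) (some w) : ℝ) * (g w + 1) :=
          Finset.sum_le_sum fun w _ => mul_le_mul_of_nonneg_left
            (Nat.ceil_lt_add_one (hsuper.nonneg w)).le (Nat.cast_nonneg _)
      _ = ∑ w, (S.mult (some u) (some w) : ℝ) * g w +
            (∑ w, S.mult (some u) (some w) : ℕ) := by
          simp only [mul_add, mul_one, Finset.sum_add_distrib, Nat.cast_sum]
      _ ≤ _ := by gcongr; exact S.sum_mult_le_degree u
  linarith

end Laplacian

/-- No nonempty set of vertices inside `Z` is a forbidden subconfiguration of `c` in the sense of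
Dhar: each of them has a vertex holding at least as many particles as it has edges into the set. -/
def AllowedOn (c : V → ℕ) (Z : Set V) : Prop :=
  ∀ F : Finset V, F.Nonempty → ↑F ⊆ Z → ∃ u ∈ F, ∑ w ∈ F, S.mult (some u) (some w) ≤ c u

variable {S} {t : ℕ} {c c' d z : V → ℕ} {v : V}

theorem AllowedOn.topplesAt {Z : Set V} (h : S.AllowedOn c Z) (hv : S.TopplesAt v c c') :
    S.AllowedOn c' (insert v Z) := by
  classical
  intro F hF hFZ
  by_cases hFv : F = {v}
  · exact ⟨v, by simp [hFv], by simp [hFv, S.mult_self]⟩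
  obtain ⟨u, huF, hu⟩ := h (F.erase v)
    (Finset.nonempty_iff_ne_empty.2 fun he =>
      ((Finset.erase_eq_empty_iff F v).1 he).elim hF.ne_empty hFv)
    (by rwa [Finset.coe_erase, Set.sdiff_singleton_subset_iff])
  refine ⟨u, Finset.mem_of_mem_erase huF, ?_⟩
  rw [hv.2.2 u (Finset.ne_of_mem_erase huF), S.mult_symm (some v)]
  calc ∑ w ∈ F, S.mult (some u) (some w)
      ≤ ∑ w ∈ insert v (F.erase v), S.mult (some u) (some w) :=
        Finset.sum_le_sum_of_subset (Finset.subset_insert_iff.2 subset_rfl)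
    _ = ∑ w ∈ F.erase v, S.mult (some u) (some w) + S.mult (some u) (some v) := by
        rw [Finset.sum_insert (Finset.notMem_erase v F), add_comm]
    _ ≤ c u + S.mult (some u) (some v) := Nat.add_le_add_right hu _

theorem exists_topplesAt (hv : S.degree v ≤ c v) : ∃ c', S.TopplesAt v c c' := by
  classical
  exact ⟨Function.update (fun u => c u + S.mult (some v) (some u)) v (c v - S.degree v), hv,
    Function.update_self .., fun u hu => Function.update_of_ne hu ..⟩

variable [DecidableEq V]

theorem TopplesAt.cast_apply (h : S.TopplesAt v c c') (u : V) :
    (c' u : ℝ) = c u - S.laplacian u v := by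
  rw [laplacian_apply]
  obtain rfl | huv := eq_or_ne u v
  · simp [h.2.1, Nat.cast_sub h.1, S.mult_self]
  · simp [h.2.2 u huv, huv, S.mult_symm (some v)]

theorem laplacian_mulVec_natCast_add_single (w : V → ℕ) (v u : V) :
    (S.laplacian *ᵥ fun y => ((w + Pi.single v 1 : V → ℕ) y : ℝ)) u =
      (S.laplacian *ᵥ fun y => (w y : ℝ)) u + S.laplacian u v := by
  have hcast : (fun y => ((w + Pi.single v 1 : V → ℕ) y : ℝ)) =
      (fun y => (w y : ℝ)) + Pi.single v 1 := by
    ext y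
    obtain rfl | hy := eq_or_ne y v <;> simp [*]
  rw [hcast, Matrix.mulVec_add, Matrix.mulVec_single_one, Pi.add_apply, Matrix.col_apply]

theorem AllowedOn.exists_degree_le {w : V → ℕ} (hc : S.AllowedOn c Set.univ) (hw : w ≠ 0)
    (hd : ∀ u, (d u : ℝ) = c u + (S.laplacian *ᵥ fun y => (w y : ℝ)) u) :
    ∃ v, 0 < w v ∧ S.degree v ≤ d v := by
  obtain ⟨u₀, hu₀⟩ := Function.ne_iff.1 hw
  obtain ⟨a, -, ha⟩ := Finset.exists_max_image Finset.univ w ⟨u₀, Finset.mem_univ u₀⟩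
  have ha_pos : 0 < w a := (Nat.pos_of_ne_zero hu₀).trans_le (ha u₀ (Finset.mem_univ u₀))
  -- Among the vertices that remain to be toppled most often, one can be toppled now.
  obtain ⟨v, hvF, hv⟩ := hc {u | w u = w a} ⟨a, by simp⟩ (Set.subset_univ _)
  have hva : w v = w a := by simpa using hvF
  refine ⟨v, hva ▸ ha_pos, ?_⟩
  have hsum : ∑ y, S.mult (some v) (some y) * w y ≤ S.degree v * (w v - 1) + c v := by
    calc ∑ y, S.mult (some v) (some y) * w y
        ≤ ∑ y, (S.mult (some v) (some y) * (w v - 1) +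
            if w y = w a then S.mult (some v) (some y) else 0) := by
          refine Finset.sum_le_sum fun y _ => ?_
          have hy := ha y (Finset.mem_univ y)
          split_ifs with h
          · rw [← Nat.mul_succ, h, hva, Nat.succ_eq_add_one, Nat.sub_add_cancel ha_pos]
          · exact Nat.mul_le_mul_left _ (by omega)
      _ = (∑ y, S.mult (some v) (some y)) * (w v - 1) +
            ∑ y with w y = w a, S.mult (some v) (some y) := by
          rw [Finset.sum_add_distrib, Finset.sum_mul, Finset.sum_filter]
      _ ≤ S.degree v * (w v - 1) + c v :=
          Nat.add_le_add (Nat.mul_le_mul_right _ (S.sum_mult_le_degree v)) hv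
  obtain ⟨m, hm⟩ := Nat.exists_eq_add_one.2 (hva ▸ ha_pos : 0 < w v)
  rw [hm, Nat.add_sub_cancel] at hsum
  have hdv := hd v
  rw [laplacian_mulVec_apply, hm] at hdv
  have hsum' : ∑ y, (S.mult (some v) (some y) : ℝ) * w y ≤ S.degree v * m + c v := by
    exact_mod_cast hsum
  have : (S.degree v : ℝ) ≤ d v := by push_cast at hdv; linarith
  exact_mod_cast this

theorem AllowedOn.topplesTo {w : V → ℕ} (hc : S.AllowedOn c Set.univ)
    (hd : ∀ u, (d u : ℝ) = c u + (S.laplacian *ᵥ fun y => (w y : ℝ)) u) : S.TopplesTo d c := by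
  induction hk : ∑ u, w u generalizing w d with
  | zero =>
    have hw : w = 0 := funext fun u => by simpa using Finset.sum_eq_zero_iff.1 hk u
    have hdc : d = c := funext fun u => by
      simpa [hw, ← Pi.zero_def] using hd u
    exact hdc ▸ Relation.ReflTransGen.refl
  | succ k ih =>
    have hw : w ≠ 0 := by rintro rfl; simp at hk
    obtain ⟨v, hwv, hv⟩ := hc.exists_degree_le hw hd
    obtain ⟨d', hd'⟩ := exists_topplesAt hv
    have hle : Pi.single v 1 ≤ w := update_le_iff.2 ⟨hwv, fun _ _ => Nat.zero_le _⟩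
    obtain ⟨w, rfl⟩ : ∃ w' : V → ℕ, w = w' + Pi.single v 1 :=
      ⟨w - Pi.single v 1, (tsub_add_cancel_of_le hle).symm⟩
    refine Relation.ReflTransGen.head ⟨v, hd'⟩ (ih (w := w) (fun u => ?_) ?_)
    · rw [hd'.cast_apply, hd, laplacian_mulVec_natCast_add_single]
      ring
    · simpa [Finset.sum_add_distrib] using hk

omit [DecidableEq V] in
theorem AllowedOn.recurrent (hc : S.AllowedOn c Set.univ) : S.Recurrent c := by
  classical
  intro c'
  obtain ⟨w, hw⟩ := S.exists_nat_le_laplacian_mulVec c'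
  have hle : ∀ u, c' u + ∑ y, S.mult (some u) (some y) * w y ≤ S.degree u * w u := fun u => by
    have h := hw u
    rw [laplacian_mulVec_apply, le_sub_iff_add_le] at h
    exact_mod_cast h
  refine ⟨fun u => c u + (S.degree u * w u - ∑ y, S.mult (some u) (some y) * w y), fun u => ?_,
    hc.topplesTo (w := w) fun u => ?_⟩
  · exact (Nat.le_sub_of_add_le (hle u)).trans (Nat.le_add_left _ _)
  · rw [laplacian_mulVec_apply, Nat.cast_add, Nat.cast_sub (le_of_add_le_right (hle u))]
    push_cast
    rfl

variable (S)

/-- `z` counts the topplings at each vertex in some history of `t` additions of particles to the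
empty configuration and of topplings which ends in `c`. The two fields are what the argument retains
of such a history: the conservation of particles, where `x u` particles were added at `u`, and
the absence of forbidden subconfigurations among the vertices that have toppled. -/
structure IsOdometer (t : ℕ) (z c : V → ℕ) : Prop where
  balance : ∃ x : V → ℕ, ∑ u, x u = t ∧
    ∀ u, (x u : ℝ) = c u + (S.laplacian *ᵥ fun y => (z y : ℝ)) u
  allowedOn : S.AllowedOn c {u | 0 < z u}

variable {S}

theorem IsOdometer.topplesAt (h : S.IsOdometer t z c) (hv : S.TopplesAt v c c') :
    S.IsOdometer t (z + Pi.single v 1) c' := by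
  obtain ⟨⟨x, hx, hbalance⟩, hallowed⟩ := h
  refine ⟨⟨x, hx, fun u => ?_⟩, ?_⟩
  · rw [hbalance, hv.cast_apply, laplacian_mulVec_natCast_add_single]
    ring
  · convert hallowed.topplesAt hv using 1
    ext u
    obtain rfl | hu := eq_or_ne u v <;> simp [*]

theorem IsOdometer.exists_of_topplesTo (h : S.IsOdometer t z c) (hc : S.TopplesTo c c') :
    ∃ z', S.IsOdometer t z' c' := by
  induction hc with
  | refl => exact ⟨z, h⟩
  | tail _ hstep ih =>
    obtain ⟨z', hz'⟩ := ih
    obtain ⟨v, hv⟩ := hstep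
    exact ⟨_, hz'.topplesAt hv⟩

theorem IsOdometer.add_single (h : S.IsOdometer t z c) (v : V) :
    S.IsOdometer (t + 1) z (c + Pi.single v 1) := by
  obtain ⟨⟨x, hx, hbalance⟩, hallowed⟩ := h
  refine ⟨⟨x + Pi.single v 1, by simp [Finset.sum_add_distrib, hx], fun u => ?_⟩,
    fun F hF hFz => (hallowed F hF hFz).imp fun u => And.imp_right (·.trans le_self_add)⟩
  simp only [Pi.add_apply, Nat.cast_add, hbalance]
  ring

theorem TransientRun.exists_isOdometer (h : S.TransientRun t c) : ∃ z, S.IsOdometer t z c := by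
  induction h with
  | empty _ =>
    refine ⟨0, ⟨0, by simp, by simp [← Pi.zero_def]⟩, fun F ⟨u, hu⟩ hFZ => ?_⟩
    exact absurd (hFZ hu) (by simp)
  | add v _ hc _ _ ih =>
    obtain ⟨z, hz⟩ := ih
    exact (hz.add_single v).exists_of_topplesTo hc

theorem TransientRun.transient (h : S.TransientRun t c) : S.Transient c := by
  cases h <;> assumption

theorem TransientRun.le_degree (h : S.TransientRun t c) (u : V) : c u ≤ S.degree u := by
  cases h with
  | empty _ => exact Nat.zero_le _
  | add _ _ _ hstable _ => exact (hstable u).le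

theorem TransientRun.exists_odometer_eq_zero (h : S.TransientRun t c) :
    ∃ z, S.IsOdometer t z c ∧ ∃ v, z v = 0 := by
  obtain ⟨z, hz⟩ := h.exists_isOdometer
  refine ⟨z, hz, ?_⟩
  by_contra! hpos
  refine h.transient (AllowedOn.recurrent fun F hF _ => hz.allowedOn F hF fun u _ => ?_)
  exact Nat.pos_of_ne_zero (hpos u)

theorem TransientRun.exists_mul_le_sum_green (h : S.TransientRun t c) :
    ∃ v, ∀ ε : ℝ, (∀ u, ε ≤ S.green v u) → t * ε ≤ ∑ u, S.green v u * S.degree u := by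
  obtain ⟨z, ⟨⟨x, hx, hbalance⟩, -⟩, v, hv⟩ := h.exists_odometer_eq_zero
  refine ⟨v, fun ε hε => ?_⟩
  calc t * ε = ∑ u, ε * x u := by rw [← Finset.mul_sum, ← hx, Nat.cast_sum, mul_comm]
    _ ≤ ∑ u, S.green v u * x u :=
        Finset.sum_le_sum fun u _ => mul_le_mul_of_nonneg_right (hε u) (Nat.cast_nonneg _)
    _ = ∑ u, S.green v u * c u + z v := by
        simp only [hbalance, mul_add, Finset.sum_add_distrib, sum_green_mul_laplacian_mulVec]
    _ = ∑ u, S.green v u * c u := by rw [hv, Nat.cast_zero, add_zero]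
    _ ≤ ∑ u, S.green v u * S.degree u :=
        Finset.sum_le_sum fun u _ => mul_le_mul_of_nonneg_left
          (Nat.cast_le.2 (h.le_degree u)) (S.green_nonneg v u)

end Sandpile

/-- A superharmonic comparison function on `ℤ²` off the origin and its four neighbours, growing like
the potential kernel of the simple random walk. It is `0` at these five points: at the origin
because `Real.log (-1) = 0`. -/
noncomputable def discreteLog (x y : ℤ) : ℝ := Real.log (2 * ((x : ℝ) ^ 2 + y ^ 2) - 1)

theorem discreteLog_nonneg (x y : ℤ) : 0 ≤ discreteLog x y := by
  have h := Real.log_intCast_nonneg (2 * (x ^ 2 + y ^ 2) - 1)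
  push_cast at h
  exact h

theorem log_le_discreteLog {R : ℕ} (hR : 1 ≤ R) {x y : ℤ} (h : (R : ℤ) ^ 2 ≤ x ^ 2 + y ^ 2) :
    Real.log (2 * (R : ℝ) ^ 2 - 1) ≤ discreteLog x y := by
  have hR' : (1 : ℝ) ≤ R := by exact_mod_cast hR
  have h' : (R : ℝ) ^ 2 ≤ (x : ℝ) ^ 2 + y ^ 2 := by exact_mod_cast h
  exact Real.log_le_log (by nlinarith) (by linarith)

theorem sum_discreteLog_le {x y : ℤ} (h : 2 ≤ x ^ 2 + y ^ 2) :
    discreteLog (x - 1) y + discreteLog (x + 1) y + (discreteLog x (y - 1) + discreteLog x (y + 1))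
      ≤ 4 * discreteLog x y := by
  have hpos : ∀ {a b : ℤ}, 1 ≤ a ^ 2 + b ^ 2 → 0 < 2 * ((a : ℝ) ^ 2 + b ^ 2) - 1 :=
    fun {a b} hab => by exact_mod_cast (by linarith : 0 < 2 * (a ^ 2 + b ^ 2) - 1)
  have h₁ := hpos (a := x - 1) (b := y) (by nlinarith)
  have h₂ := hpos (a := x + 1) (b := y) (by nlinarith)
  have h₃ := hpos (a := x) (b := y - 1) (by nlinarith)
  have h₄ := hpos (a := x) (b := y + 1) (by nlinarith)
  have h₀ := hpos (a := x) (b := y) (by linarith)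
  simp only [discreteLog]
  rw [← Real.log_mul h₁.ne' h₂.ne', ← Real.log_mul h₃.ne' h₄.ne',
    ← Real.log_mul (mul_pos h₁ h₂).ne' (mul_pos h₃ h₄).ne', ← Real.log_rpow h₀]
  refine Real.log_le_log (by positivity) ?_
  norm_num
  -- The difference of the two sides is `64 * (x ^ 2 - y ^ 2) ^ 2`.
  linarith [sq_nonneg ((x : ℝ) ^ 2 - y ^ 2)]

theorem one_sub_div_le_log_sub_log {r R : ℝ} (hr : 1 ≤ r) (hR : r ≤ R) :
    1 - r / R ≤ Real.log (2 * R ^ 2 - 1) - Real.log (2 * r ^ 2 - 1) := by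
  have hr₀ : 0 < r := by linarith
  have hR₀ : 0 < R := by linarith
  have hr' : 0 < 2 * r ^ 2 - 1 := by nlinarith
  have hR' : 0 < 2 * R ^ 2 - 1 := by nlinarith
  calc 1 - r / R = 1 - (R / r)⁻¹ := by rw [inv_div]
    _ ≤ Real.log (R / r) := Real.one_sub_inv_le_log_of_pos (div_pos hR₀ hr₀)
    _ ≤ Real.log ((2 * R ^ 2 - 1) / (2 * r ^ 2 - 1)) := by
        refine Real.log_le_log (div_pos hR₀ hr₀) ((div_le_div_iff₀ hr₀ hr').2 ?_)
        nlinarith [mul_nonneg (mul_pos hr₀ hR₀).le (sub_nonneg.2 hR)]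
    _ = Real.log (2 * R ^ 2 - 1) - Real.log (2 * r ^ 2 - 1) := Real.log_div hR'.ne' hr'.ne'

/-- The piecewise linear function with value `1` at `m` which vanishes at `-1` and at `n`. -/
noncomputable def tent (n m x : ℤ) : ℝ := min ((x + 1) / (m + 1)) ((n - x) / (n - m))

section Tent

variable {n m x : ℤ}

theorem tent_of_le (hm : -1 < m) (hmn : m < n) (hx : x ≤ m) : tent n m x = (x + 1) / (m + 1) := by
  have hm' : (-1 : ℝ) < m := by exact_mod_cast hm
  have hmn' : (m : ℝ) < n := by exact_mod_cast hmn
  have hx' : (x : ℝ) ≤ m := by exact_mod_cast hx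
  refine min_eq_left (le_trans (b := 1) ?_ ?_)
  · rw [div_le_one (by linarith)]; linarith
  · rw [one_le_div (by linarith)]; linarith

theorem tent_of_ge (hm : -1 < m) (hmn : m < n) (hx : m ≤ x) : tent n m x = (n - x) / (n - m) := by
  have hm' : (-1 : ℝ) < m := by exact_mod_cast hm
  have hmn' : (m : ℝ) < n := by exact_mod_cast hmn
  have hx' : (m : ℝ) ≤ x := by exact_mod_cast hx
  refine min_eq_right (le_trans (b := 1) ?_ ?_)
  · rw [div_le_one (by linarith)]; linarith
  · rw [one_le_div (by linarith)]; linarith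

theorem tent_neg_one (hm : -1 < m) (hmn : m < n) : tent n m (-1) = 0 := by
  rw [tent_of_le hm hmn hm.le]
  simp

theorem tent_right (hm : -1 < m) (hmn : m < n) : tent n m n = 0 := by
  rw [tent_of_ge hm hmn hmn.le]
  simp

theorem tent_self (hm : -1 < m) (hmn : m < n) : tent n m m = 1 := by
  rw [tent_of_le hm hmn le_rfl]
  have : (-1 : ℝ) < m := by exact_mod_cast hm
  exact div_self (by linarith)

theorem tent_sub_one_add_tent_add_one (hm : -1 < m) (hmn : m < n) (hx : x ≠ m) :
    tent n m (x - 1) + tent n m (x + 1) = 2 * tent n m x := by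
  rcases hx.lt_or_gt with hx | hx
  · rw [tent_of_le hm hmn (by omega), tent_of_le hm hmn (by omega), tent_of_le hm hmn hx.le]
    push_cast
    ring
  · rw [tent_of_ge hm hmn (by omega), tent_of_ge hm hmn (by omega), tent_of_ge hm hmn hx.le]
    push_cast
    ring

theorem mul_le_sq_mul_tent (hm : -1 < m) (hmn : m < n) (hx : -1 < x) (hxn : x < n) :
    ((x : ℝ) + 1) * (n - x) ≤ (n + 1) ^ 2 * tent n m x := by
  have hm' : (0 : ℝ) ≤ m := by exact_mod_cast (by omega : 0 ≤ m)
  have hmn' : (m : ℝ) + 1 ≤ n := by exact_mod_cast hmn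
  have hx' : (0 : ℝ) ≤ x := by exact_mod_cast (by omega : 0 ≤ x)
  have hxn' : (x : ℝ) + 1 ≤ n := by exact_mod_cast hxn
  rw [tent, mul_min_of_nonneg _ _ (by positivity), le_min_iff, ← mul_div_assoc, ← mul_div_assoc,
    le_div_iff₀ (by linarith), le_div_iff₀ (by linarith)]
  constructor
  · nlinarith [mul_le_mul (show (n : ℝ) - x ≤ n + 1 by linarith)
      (show (m : ℝ) + 1 ≤ n + 1 by linarith) (by linarith) (by linarith)]
  · nlinarith [mul_le_mul (show (x : ℝ) + 1 ≤ n + 1 by linarith)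
      (show (n : ℝ) - m ≤ n + 1 by linarith) (by linarith) (by linarith)]

theorem one_div_le_tent (hm : -1 < m) (hmn : m < n) (hx : -1 < x) (hxn : x < n) :
    1 / ((n : ℝ) + 1) ≤ tent n m x := by
  have hm' : (0 : ℝ) ≤ m := by exact_mod_cast (by omega : 0 ≤ m)
  have hmn' : (m : ℝ) + 1 ≤ n := by exact_mod_cast hmn
  have hx' : (0 : ℝ) ≤ x := by exact_mod_cast (by omega : 0 ≤ x)
  have hxn' : (x : ℝ) + 1 ≤ n := by exact_mod_cast hxn
  exact le_min (div_le_div₀ (by linarith) (by linarith) (by linarith) (by linarith))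
    (div_le_div₀ (by linarith) (by linarith) (by linarith) (by linarith))

end Tent

namespace gridSandpile

open Sandpile

variable {n : ℕ}

open Classical in
theorem sum_pathGraph_adj {R : Type*} [AddCommMonoid R] (i : Fin n) (f : ℤ → R) :
    (∑ k : Fin n, if (SimpleGraph.pathGraph n).Adj i k then f k else 0) =
      (if (i : ℕ) = 0 then 0 else f (i - 1)) + if (i : ℕ) + 1 = n then 0 else f (i + 1) := by
  have hsplit : ∀ k : Fin n, (if (SimpleGraph.pathGraph n).Adj i k then f k else 0) =
      (if (k : ℕ) + 1 = i then f (i - 1) else 0) + if (k : ℕ) = i + 1 then f (i + 1) else 0 := by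
    intro k
    rw [SimpleGraph.pathGraph_adj]
    by_cases hleft : (k : ℕ) + 1 = i
    · simp [← hleft, add_assoc]
    · by_cases hright : (k : ℕ) = i + 1
      · simp [hright, add_assoc]
      · simp [hleft, hright, Ne.symm hright]
  rw [Finset.sum_congr rfl fun k _ => hsplit k, Finset.sum_add_distrib]
  congr 1
  · split_ifs with hi
    · exact Finset.sum_eq_zero fun k _ => if_neg (by omega)
    · rw [Finset.sum_eq_single (⟨i - 1, by omega⟩ : Fin n)]
      · exact if_pos (Nat.sub_add_cancel (Nat.pos_of_ne_zero hi))
      · exact fun k _ hk => if_neg fun h => hk (Fin.ext (by simp only; omega))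
      · simp
  · split_ifs with hi
    · exact Finset.sum_eq_zero fun k _ => if_neg (by omega)
    · rw [Finset.sum_eq_single (⟨i + 1, by omega⟩ : Fin n)]
      · exact if_pos rfl
      · exact fun k _ hk => if_neg fun h => hk (Fin.ext h)
      · simp

open Classical in
theorem sum_mult_mul {R : Type*} [NonAssocSemiring R] (p : Fin n × Fin n)
    (f : Fin n × Fin n → R) :
    ∑ q, ((gridSandpile n).mult (some p) (some q) : R) * f q =
      (∑ k, if (SimpleGraph.pathGraph n).Adj p.1 k then f (k, p.2) else 0) +
        ∑ k, if (SimpleGraph.pathGraph n).Adj p.2 k then f (p.1, k) else 0 := by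
  have hsplit : ∀ q, ((gridSandpile n).mult (some p) (some q) : R) * f q =
      (if p.2 = q.2 then if (SimpleGraph.pathGraph n).Adj p.1 q.1 then f (q.1, p.2) else 0 else 0) +
        if p.1 = q.1 then if (SimpleGraph.pathGraph n).Adj p.2 q.2 then f (p.1, q.2) else 0
          else 0 := by
    rintro ⟨k, l⟩
    obtain ⟨i, j⟩ := p
    simp only [gridSandpile, gridMult, SimpleGraph.boxProd_adj]
    by_cases hi : i = k <;> by_cases hj : j = l <;> simp [hi, hj]
  rw [Finset.sum_congr rfl fun q _ => hsplit q, Finset.sum_add_distrib, Fintype.sum_prod_type,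
    Fintype.sum_prod_type_right]
  simp only [Finset.sum_ite_eq, Finset.mem_univ, if_true]

theorem degree_eq_four (hn : 2 ≤ n) (p : Fin n × Fin n) : (gridSandpile n).degree p = 4 := by
  have hsum := sum_mult_mul p (fun _ => 1)
  rw [sum_pathGraph_adj p.1 fun _ => 1, sum_pathGraph_adj p.2 fun _ => 1] at hsum
  simp only [mul_one, Nat.cast_id] at hsum
  rw [Sandpile.degree, Fintype.sum_option, hsum]
  change gridSinkEdges p + _ = 4
  simp only [gridSinkEdges, GridExtreme]
  split_ifs <;> omega

theorem degree_one (p : Fin 1 × Fin 1) : (gridSandpile 1).degree p = 2 := by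
  rw [Sandpile.degree, Fintype.sum_option, Fintype.sum_subsingleton _ p,
    (gridSandpile 1).mult_self]
  change gridSinkEdges p + 0 = 2
  simp [gridSinkEdges, GridExtreme]

theorem laplacian_mulVec_le (hn : 2 ≤ n) {F : ℤ → ℤ → ℝ}
    (hF : ∀ k : Fin n, F (-1) k ≤ 0 ∧ F n k ≤ 0 ∧ F k (-1) ≤ 0 ∧ F k n ≤ 0) (p : Fin n × Fin n) :
    ((gridSandpile n).laplacian *ᵥ fun q => F q.1 q.2) p ≤
      4 * F p.1 p.2 -
        (F (p.1 - 1) p.2 + F (p.1 + 1) p.2 + (F p.1 (p.2 - 1) + F p.1 (p.2 + 1))) := by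
  rw [laplacian_mulVec_apply, degree_eq_four hn, sum_mult_mul,
    sum_pathGraph_adj p.1 fun x => F x p.2,
    sum_pathGraph_adj p.2 fun y => F p.1 y, Nat.cast_ofNat]
  have hfirst : ∀ k : Fin n, (k : ℕ) = 0 → (k : ℤ) - 1 = -1 := fun k hk => by omega
  have hlast : ∀ k : Fin n, (k : ℕ) + 1 = n → (k : ℤ) + 1 = n := fun k hk => by omega
  refine sub_le_sub_left (add_le_add (add_le_add ?_ ?_) (add_le_add ?_ ?_)) _ <;> split_ifs with h
  · exact hfirst _ h ▸ (hF p.2).1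
  · exact le_rfl
  · exact hlast _ h ▸ (hF p.2).2.1
  · exact le_rfl
  · exact hfirst _ h ▸ (hF p.1).2.2.1
  · exact le_rfl
  · exact hlast _ h ▸ (hF p.1).2.2.2
  · exact le_rfl

theorem laplacian_mulVec_comp_swap (hn : 2 ≤ n) (f : Fin n × Fin n → ℝ) (p : Fin n × Fin n) :
    ((gridSandpile n).laplacian *ᵥ (f ∘ Prod.swap)) p =
      ((gridSandpile n).laplacian *ᵥ f) p.swap := by
  simp only [laplacian_mulVec_apply, degree_eq_four hn, sum_mult_mul, Function.comp_apply,
    Prod.swap_prod_mk, Prod.fst_swap, Prod.snd_swap]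
  rw [add_comm]

theorem mult_eq_one {p q : Fin n × Fin n}
    (h : ((p.1 : ℤ) - q.1) ^ 2 + ((p.2 : ℤ) - q.2) ^ 2 = 1) :
    (gridSandpile n).mult (some p) (some q) = 1 := by
  refine if_pos ?_
  rw [SimpleGraph.boxProd_adj, SimpleGraph.pathGraph_adj, SimpleGraph.pathGraph_adj, Fin.ext_iff,
    Fin.ext_iff]
  have h₁ : ((p.1 : ℤ) - q.1) ^ 2 ≤ 1 := by linarith [sq_nonneg ((p.2 : ℤ) - q.2)]
  have h₂ : ((p.2 : ℤ) - q.2) ^ 2 ≤ 1 := by linarith [sq_nonneg ((p.1 : ℤ) - q.1)]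
  rw [sq_le_one_iff_abs_le_one, Int.abs_le_one_iff] at h₁ h₂
  rcases h₁ with h₁ | h₁ | h₁ <;> rcases h₂ with h₂ | h₂ | h₂ <;> rw [h₁, h₂] at h <;> omega

theorem le_four_mul_of_superharmonic (hn : 2 ≤ n) {f : Fin n × Fin n → ℝ}
    (hf : (gridSandpile n).Superharmonic f) {p u : Fin n × Fin n}
    (h : ((u.1 : ℤ) - p.1) ^ 2 + ((u.2 : ℤ) - p.2) ^ 2 ≤ 1) : f p ≤ 4 * f u := by
  rcases h.lt_or_eq with h | h
  · obtain ⟨h₁, h₂⟩ := (add_eq_zero_iff_of_nonneg (sq_nonneg _) (sq_nonneg _)).1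
      (le_antisymm (Int.lt_add_one_iff.1 h) (by positivity))
    obtain rfl : u = p := Prod.ext
      (Fin.ext (by exact_mod_cast sub_eq_zero.1 (pow_eq_zero_iff two_ne_zero |>.1 h₁)))
      (Fin.ext (by exact_mod_cast sub_eq_zero.1 (pow_eq_zero_iff two_ne_zero |>.1 h₂)))
    linarith [show 0 ≤ f u from hf.nonneg u]
  · have := hf.mult_mul_le_degree_mul u p
    rwa [mult_eq_one h, degree_eq_four hn, Nat.cast_one, one_mul, Nat.cast_ofNat] at this

section Harnack

variable {f : Fin n × Fin n → ℝ}

theorem mul_log_sub_discreteLog_le (hn : 2 ≤ n) (hf : (gridSandpile n).Superharmonic f)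
    {p : Fin n × Fin n} {R : ℕ} (hR : 1 ≤ R) (h₁ : R ≤ p.1 + 1 ∧ p.1 + R ≤ n)
    (h₂ : R ≤ p.2 + 1 ∧ p.2 + R ≤ n) (u : Fin n × Fin n) :
    f p * (Real.log (2 * (R : ℝ) ^ 2 - 1) - discreteLog (u.1 - p.1) (u.2 - p.2)) ≤
      4 * Real.log (2 * (R : ℝ) ^ 2 - 1) * f u := by
  set ℓ := Real.log (2 * (R : ℝ) ^ 2 - 1)
  have hℓ : 0 ≤ ℓ := by simpa [discreteLog] using discreteLog_nonneg R 0
  have hf₀ : 0 ≤ f := hf.nonneg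
  let w : Fin n × Fin n → ℝ := fun q => ℓ - discreteLog (q.1 - p.1) (q.2 - p.2)
  suffices hmin : 0 ≤ (4 * ℓ) • f - f p • w by simpa using hmin u
  refine nonneg_of_laplacian_mulVec_nonneg (S := gridSandpile n)
    (D := {q | 2 ≤ ((q.1 : ℤ) - p.1) ^ 2 + ((q.2 : ℤ) - p.2) ^ 2}) (fun q hq => ?_) fun q hq => ?_
  · have hw : ((gridSandpile n).laplacian *ᵥ w) q ≤ 0 := by
      refine (laplacian_mulVec_le hn (F := fun x y => ℓ - discreteLog (x - p.1) (y - p.2))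
        (fun k => ⟨?_, ?_, ?_, ?_⟩) q).trans ?_
      iterate 4
        · refine sub_nonpos.2 (log_le_discreteLog hR ?_)
          nlinarith [sq_nonneg ((k : ℤ) - p.1), sq_nonneg ((k : ℤ) - p.2)]
      · have := sum_discreteLog_le hq
        simp only [sub_right_comm _ (1 : ℤ), add_sub_right_comm _ (1 : ℤ)]
        linarith
    rw [Matrix.mulVec_sub, Matrix.mulVec_smul, Matrix.mulVec_smul, Pi.sub_apply, Pi.smul_apply,
      Pi.smul_apply, smul_eq_mul, smul_eq_mul, sub_nonneg]
    exact (mul_nonpos_of_nonneg_of_nonpos (hf₀ p) hw).trans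
      (mul_nonneg (mul_nonneg zero_le_four hℓ) (hf q))
  · have hfq := le_four_mul_of_superharmonic hn hf (Int.lt_add_one_iff.1 (not_le.1 hq))
    have hwq : w q ≤ ℓ := sub_le_self _ (discreteLog_nonneg _ _)
    rw [Pi.sub_apply, Pi.smul_apply, Pi.smul_apply, smul_eq_mul, smul_eq_mul, sub_nonneg]
    calc f p * w q ≤ f p * ℓ := mul_le_mul_of_nonneg_left hwq (hf₀ p)
      _ ≤ 4 * f q * ℓ := mul_le_mul_of_nonneg_right hfq hℓ
      _ = 4 * ℓ * f q := by ring

theorem one_le_log_add_one (hn : 2 ≤ n) : 1 ≤ Real.log (n + 1) := by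
  have hn' : (2 : ℝ) ≤ n := by exact_mod_cast hn
  rw [Real.le_log_iff_exp_le (by positivity)]
  linarith [Real.exp_one_lt_d9]

theorem log_two_mul_sq_sub_one_le {R : ℕ} (hR : 1 ≤ R) (hRn : 2 * R ≤ n + 1) :
    Real.log (2 * (R : ℝ) ^ 2 - 1) ≤ 2 * Real.log (n + 1) := by
  have hR' : (1 : ℝ) ≤ R := by exact_mod_cast hR
  have hRn' : 2 * (R : ℝ) ≤ n + 1 := by exact_mod_cast hRn
  rw [← Real.log_rpow (by positivity), Real.rpow_ofNat]
  exact Real.log_le_log (by nlinarith) (by nlinarith)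

theorem mul_radius_sub_abs_le (hn : 2 ≤ n) (hf : (gridSandpile n).Superharmonic f)
    {p : Fin n × Fin n} {R : ℕ} (hR : 1 ≤ R) (h₁ : R ≤ p.1 + 1 ∧ p.1 + R ≤ n)
    (h₂ : R ≤ p.2 + 1 ∧ p.2 + R ≤ n) (x : Fin n) :
    f p * (R - |(x : ℝ) - p.1|) ≤ 8 * Real.log (n + 1) * R * f (x, p.2) := by
  have hf₀ : 0 ≤ f := hf.nonneg
  have hlog := one_le_log_add_one hn
  have hR₀ : (0 : ℝ) < R := by exact_mod_cast hR
  set r := |(x : ℝ) - p.1| with hr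
  obtain rfl | hx := eq_or_ne x p.1
  · rw [hr, sub_self, abs_zero, sub_zero, mul_comm]
    refine mul_le_mul_of_nonneg_right ?_ (hf₀ p)
    nlinarith
  have hr₁ : 1 ≤ r := by
    have hxp : (x : ℤ) - p.1 ≠ 0 := sub_ne_zero.2 (by exact_mod_cast Fin.val_ne_of_ne hx)
    simpa [hr] using (Int.cast_le (R := ℝ)).2 (Int.one_le_abs hxp)
  rcases lt_or_ge (R : ℝ) r with hRr | hrR
  · exact (mul_nonpos_of_nonneg_of_nonpos (hf₀ p) (by linarith)).trans
      (mul_nonneg (by positivity) (hf₀ _))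
  have hdisc : discreteLog (x - p.1) (p.2 - p.2) = Real.log (2 * r ^ 2 - 1) := by
    simp [discreteLog, hr, sq_abs]
  calc f p * (R - r) = R * (f p * (1 - r / R)) := by field_simp
    _ ≤ R * (f p * (Real.log (2 * (R : ℝ) ^ 2 - 1) - Real.log (2 * r ^ 2 - 1))) := by
        refine mul_le_mul_of_nonneg_left (mul_le_mul_of_nonneg_left ?_ (hf₀ p)) hR₀.le
        exact one_sub_div_le_log_sub_log hr₁ hrR
    _ ≤ R * (4 * Real.log (2 * (R : ℝ) ^ 2 - 1) * f (x, p.2)) := by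
        refine mul_le_mul_of_nonneg_left ?_ hR₀.le
        exact hdisc ▸ mul_log_sub_discreteLog_le hn hf hR h₁ h₂ (x, p.2)
    _ ≤ R * (4 * (2 * Real.log (n + 1)) * f (x, p.2)) := by
        gcongr
        · exact hf₀ _
        · exact log_two_mul_sq_sub_one_le hR (by omega)
    _ = 8 * Real.log (n + 1) * R * f (x, p.2) := by ring

variable {o : Fin n}

theorem centre_mul_add_one_le (hn : 2 ≤ n) (ho : 2 * (o : ℕ) + 1 ≤ n)
    (hf : (gridSandpile n).Superharmonic f) {x : Fin n} (hx : x ≤ o) :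
    f (o, o) * (x + 1) ≤ 8 * Real.log (n + 1) * (o + 1) * f (x, o) := by
  have haxis := mul_radius_sub_abs_le hn hf (p := (o, o)) (R := o + 1) (Nat.le_add_left ..)
    ⟨le_rfl, by simp only; omega⟩ ⟨le_rfl, by simp only; omega⟩ x
  have hx' : (x : ℝ) - o ≤ 0 := sub_nonpos.2 (by exact_mod_cast hx)
  rw [abs_of_nonpos hx', Nat.cast_add_one] at haxis
  exact (by ring : f (o, o) * ((x : ℝ) + 1) = f (o, o) * (o + 1 - -(x - o))).trans_le haxis

theorem centre_mul_sub_le (hn : 2 ≤ n) (ho : 2 * (o : ℕ) + 1 ≤ n ∧ n ≤ 2 * (o : ℕ) + 2)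
    (hf : (gridSandpile n).Superharmonic f) {x : Fin n} (hx : o < x) :
    f (o, o) * (n - x) ≤ 32 * Real.log (n + 1) * (o + 1) * f (x, o) := by
  have hrev : (o.rev : ℕ) = n - (o + 1) := Fin.val_rev o
  have hadj : f (o, o) ≤ 4 * f (o.rev, o) := by
    refine le_four_mul_of_superharmonic hn hf ?_
    obtain h | h : (o.rev : ℤ) - o = 0 ∨ (o.rev : ℤ) - o = 1 := by omega
    all_goals norm_num [h, sub_self, -Fin.val_rev]
  have haxis := mul_radius_sub_abs_le hn hf (p := (o.rev, o)) (R := o + 1) (Nat.le_add_left ..)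
    ⟨by simp only; omega, by simp only; omega⟩ ⟨le_rfl, by simp only; omega⟩ x
  have hx' : (0 : ℝ) ≤ (x : ℝ) - o.rev := sub_nonneg.2 (by norm_cast; omega)
  have hxn : (0 : ℝ) ≤ n - x := sub_nonneg.2 (by exact_mod_cast x.2.le)
  rw [abs_of_nonneg hx', hrev, Nat.cast_sub (by omega), Nat.cast_add_one] at haxis
  calc f (o, o) * ((n : ℝ) - x) ≤ 4 * f (o.rev, o) * (n - x) :=
        mul_le_mul_of_nonneg_right hadj hxn
    _ = 4 * (f (o.rev, o) * (o + 1 - (x - (n - (o + 1))))) := by ring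
    _ ≤ 4 * (8 * Real.log (n + 1) * (o + 1) * f (x, o)) := by gcongr
    _ = 32 * Real.log (n + 1) * (o + 1) * f (x, o) := by ring

theorem centre_mul_tent_fst_le (hn : 2 ≤ n) (ho : 2 * (o : ℕ) + 1 ≤ n ∧ n ≤ 2 * (o : ℕ) + 2)
    (hf : (gridSandpile n).Superharmonic f) (x : Fin n) :
    f (o, o) * tent n o x ≤ 32 * Real.log (n + 1) * f (x, o) := by
  have hfx : 0 ≤ f (x, o) := hf.nonneg _
  have hlog := one_le_log_add_one hn
  have ho₁ : (-1 : ℤ) < o := by omega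
  have ho₂ : (o : ℤ) < n := by omega
  have hon : (o : ℝ) + 1 ≤ n - o := by
    rw [le_sub_iff_add_le]; norm_cast; omega
  rcases le_or_gt x o with hx | hx
  · rw [tent_of_le ho₁ ho₂ (by exact_mod_cast hx), ← mul_div_assoc, Int.cast_natCast,
      Int.cast_natCast, div_le_iff₀ (by positivity)]
    calc f (o, o) * ((x : ℝ) + 1) ≤ 8 * Real.log (n + 1) * (o + 1) * f (x, o) :=
          centre_mul_add_one_le hn ho.1 hf hx
      _ ≤ 32 * Real.log (n + 1) * (o + 1) * f (x, o) := by gcongr; norm_num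
      _ = 32 * Real.log (n + 1) * f (x, o) * (o + 1) := by ring
  · rw [tent_of_ge ho₁ ho₂ (by exact_mod_cast hx.le), ← mul_div_assoc, Int.cast_natCast,
      Int.cast_natCast, Int.cast_natCast, div_le_iff₀ (by linarith [(o : ℕ).cast_nonneg (α := ℝ)])]
    calc f (o, o) * ((n : ℝ) - x) ≤ 32 * Real.log (n + 1) * (o + 1) * f (x, o) :=
          centre_mul_sub_le hn ho hf hx
      _ ≤ 32 * Real.log (n + 1) * (n - o) * f (x, o) := by gcongr
      _ = 32 * Real.log (n + 1) * f (x, o) * (n - o) := by ring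

theorem centre_mul_tent_snd_le (hn : 2 ≤ n) (ho : 2 * (o : ℕ) + 1 ≤ n ∧ n ≤ 2 * (o : ℕ) + 2)
    (hf : (gridSandpile n).Superharmonic f) (y : Fin n) :
    f (o, o) * tent n o y ≤ 32 * Real.log (n + 1) * f (o, y) :=
  centre_mul_tent_fst_le (f := f ∘ Prod.swap) hn ho
    (fun p => (hf p.swap).trans_eq (laplacian_mulVec_comp_swap hn f p).symm) y

theorem centre_mul_tent_mul_tent_le (hn : 2 ≤ n) (ho : 2 * (o : ℕ) + 1 ≤ n ∧ n ≤ 2 * (o : ℕ) + 2)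
    (hf : (gridSandpile n).Superharmonic f) (u : Fin n × Fin n) :
    f (o, o) * (tent n o u.1 * tent n o u.2) ≤ 32 * Real.log (n + 1) * f u := by
  have ho₁ : (-1 : ℤ) < o := by omega
  have ho₂ : (o : ℤ) < n := by omega
  have hf₀ : 0 ≤ f (o, o) := hf.nonneg _
  have hlog := one_le_log_add_one hn
  let η : Fin n × Fin n → ℝ := fun q => tent n o q.1 * tent n o q.2
  suffices hmin : 0 ≤ (32 * Real.log (n + 1)) • f - f (o, o) • η by simpa using hmin u
  refine nonneg_of_laplacian_mulVec_nonneg (S := gridSandpile n)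
    (D := {q | q.1 ≠ o ∧ q.2 ≠ o}) (fun q hq => ?_) fun q hq => ?_
  · have hη : ((gridSandpile n).laplacian *ᵥ η) q ≤ 0 := by
      refine (laplacian_mulVec_le hn (F := fun x y => tent n o x * tent n o y)
        (fun k => by simp [tent_neg_one ho₁ ho₂, tent_right ho₁ ho₂]) q).trans_eq ?_
      · have h₁ := tent_sub_one_add_tent_add_one ho₁ ho₂
          (x := q.1) (by exact_mod_cast Fin.val_ne_of_ne hq.1)
        have h₂ := tent_sub_one_add_tent_add_one ho₁ ho₂
          (x := q.2) (by exact_mod_cast Fin.val_ne_of_ne hq.2)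
        linear_combination -tent n o q.2 * h₁ - tent n o q.1 * h₂
    rw [Matrix.mulVec_sub, Matrix.mulVec_smul, Matrix.mulVec_smul, Pi.sub_apply, Pi.smul_apply,
      Pi.smul_apply, smul_eq_mul, smul_eq_mul, sub_nonneg]
    exact (mul_nonpos_of_nonneg_of_nonpos hf₀ hη).trans (mul_nonneg (by positivity) (hf q))
  · obtain ⟨x, y⟩ := q
    rw [Pi.sub_apply, Pi.smul_apply, Pi.smul_apply, smul_eq_mul, smul_eq_mul, sub_nonneg]
    rcases not_and_or.1 hq with h | h
    · obtain rfl : x = o := not_not.1 h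
      simpa only [η, tent_self ho₁ ho₂, one_mul] using centre_mul_tent_snd_le hn ho hf y
    · obtain rfl : y = o := not_not.1 h
      simpa only [η, tent_self ho₁ ho₂, mul_one] using centre_mul_tent_fst_le hn ho hf x

end Harnack

section Green

variable {o : Fin n}

theorem one_div_le_tent_coe (o x : Fin n) : 1 / ((n : ℝ) + 1) ≤ tent n o x := by
  simpa only [Int.cast_natCast] using
    one_div_le_tent (n := n) (m := o) (x := x) (by omega) (by omega) (by omega) (by omega)

theorem tent_coe_pos (o x : Fin n) : 0 < tent n o x :=
  lt_of_lt_of_le (by positivity) (one_div_le_tent_coe o x)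

theorem tent_mul_tent_le_green (hn : 2 ≤ n) (ho : 2 * (o : ℕ) + 1 ≤ n ∧ n ≤ 2 * (o : ℕ) + 2)
    (v u : Fin n × Fin n) :
    tent n o v.1 * tent n o v.2 * (tent n o u.1 * tent n o u.2) ≤
      4096 * Real.log (n + 1) ^ 2 * (gridSandpile n).green v u := by
  set G := (gridSandpile n).green
  have hlog := one_le_log_add_one hn
  have hη : ∀ q : Fin n × Fin n, 0 ≤ tent n o q.1 * tent n o q.2 := fun q =>
    (mul_pos (tent_coe_pos o q.1) (tent_coe_pos o q.2)).le
  have hcentre : 1 ≤ 4 * G (o, o) (o, o) := by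
    simpa [degree_eq_four hn] using (gridSandpile n).one_le_degree_mul_green_self (o, o)
  have hv := centre_mul_tent_mul_tent_le hn ho ((gridSandpile n).superharmonic_green (o, o)) v
  have hu := centre_mul_tent_mul_tent_le hn ho ((gridSandpile n).superharmonic_green v) u
  rw [(gridSandpile n).green_comm (o, o) v] at hv
  calc tent n o v.1 * tent n o v.2 * (tent n o u.1 * tent n o u.2)
      ≤ 4 * G (o, o) (o, o) * (tent n o v.1 * tent n o v.2) * (tent n o u.1 * tent n o u.2) :=
        mul_le_mul_of_nonneg_right (le_mul_of_one_le_left (hη v) hcentre) (hη u)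
    _ = 4 * (tent n o u.1 * tent n o u.2) * (G (o, o) (o, o) * (tent n o v.1 * tent n o v.2)) := by
        ring
    _ ≤ 4 * (tent n o u.1 * tent n o u.2) * (32 * Real.log (n + 1) * G v (o, o)) :=
        mul_le_mul_of_nonneg_left hv (mul_nonneg (by norm_num) (hη u))
    _ = 128 * Real.log (n + 1) * (G v (o, o) * (tent n o u.1 * tent n o u.2)) := by ring
    _ ≤ 128 * Real.log (n + 1) * (32 * Real.log (n + 1) * G v u) := by gcongr
    _ = 4096 * Real.log (n + 1) ^ 2 * G v u := by ring

theorem two_mul_sum_green_le (hn : 2 ≤ n) (v : Fin n × Fin n) :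
    2 * ∑ u, (gridSandpile n).green v u ≤ ((v.1 : ℝ) + 1) * (n - v.1) := by
  let F : ℤ → ℝ := fun x => (x + 1) * (n - x)
  let E : Fin n × Fin n → ℝ := fun q => F q.1
  have hF₀ : ∀ k : Fin n, 0 ≤ F k := fun k => by
    have hk : (k : ℝ) ≤ n := by exact_mod_cast k.2.le
    simpa only [F, Int.cast_natCast] using mul_nonneg (by positivity) (sub_nonneg.2 hk)
  have hE : ∀ u, 2 ≤ ((gridSandpile n).laplacian *ᵥ E) u := by
    intro u
    have hneg : ((gridSandpile n).laplacian *ᵥ -E) u ≤ -2 := by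
      refine (laplacian_mulVec_le hn (F := fun x _ => -F x) (fun k => ?_) u).trans_eq ?_
      · exact ⟨by simp [F], by simp [F], neg_nonpos.2 (hF₀ k), neg_nonpos.2 (hF₀ k)⟩
      · simp only [F]
        push_cast
        ring
    rw [Matrix.mulVec_neg, Pi.neg_apply] at hneg
    exact neg_le_neg_iff.1 hneg
  calc 2 * ∑ u, (gridSandpile n).green v u = ∑ u, (gridSandpile n).green v u * 2 := by
        rw [mul_comm, Finset.sum_mul]
    _ ≤ ∑ u, (gridSandpile n).green v u * ((gridSandpile n).laplacian *ᵥ E) u :=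
        Finset.sum_le_sum fun u _ =>
          mul_le_mul_of_nonneg_left (hE u) ((gridSandpile n).green_nonneg v u)
    _ = E v := (gridSandpile n).sum_green_mul_laplacian_mulVec E v
    _ = (v.1 + 1) * (n - v.1) := by simp only [E, F, Int.cast_natCast]

theorem sum_green_mul_degree_le (hn : 2 ≤ n) (o : Fin n) (v : Fin n × Fin n) :
    ∑ u, (gridSandpile n).green v u * (gridSandpile n).degree u ≤
      2 * ((n : ℝ) + 1) ^ 2 * tent n o v.1 := by
  have htent : ((v.1 : ℝ) + 1) * (n - v.1) ≤ ((n : ℝ) + 1) ^ 2 * tent n o v.1 := by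
    simpa only [Int.cast_natCast] using
      mul_le_sq_mul_tent (n := n) (m := o) (x := v.1) (by omega) (by omega) (by omega) (by omega)
  have hsum := two_mul_sum_green_le hn v
  simp only [degree_eq_four hn, ← Finset.sum_mul]
  push_cast
  linarith

end Green

theorem le_of_transientRun (hn : 2 ≤ n) {t : ℕ} {c : Fin n × Fin n → ℕ}
    (h : (gridSandpile n).TransientRun t c) :
    (t : ℝ) ≤ 8192 * (n + 1) ^ 5 * Real.log (n + 1) ^ 2 := by
  let o : Fin n := ⟨(n - 1) / 2, by omega⟩
  obtain ⟨v, hv⟩ := h.exists_mul_le_sum_green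
  have hlog := one_le_log_add_one hn
  have hgreen : ∀ u, tent n o v.1 * tent n o v.2 * (1 / ((n : ℝ) + 1)) ^ 2 /
      (4096 * Real.log (n + 1) ^ 2) ≤ (gridSandpile n).green v u := by
    intro u
    rw [div_le_iff₀' (by positivity), sq]
    refine le_trans ?_ (tent_mul_tent_le_green (o := o) hn (by simp only [o]; omega) v u)
    exact mul_le_mul_of_nonneg_left
      (mul_le_mul (one_div_le_tent_coe o u.1) (one_div_le_tent_coe o u.2) (by positivity)
        (tent_coe_pos o u.1).le)
      (mul_pos (tent_coe_pos o v.1) (tent_coe_pos o v.2)).le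
  have hcancel : t * (tent n o v.2 * (1 / ((n : ℝ) + 1)) ^ 2 / (4096 * Real.log (n + 1) ^ 2)) ≤
      2 * ((n : ℝ) + 1) ^ 2 := by
    refine le_of_mul_le_mul_right ?_ (tent_coe_pos o v.1)
    refine (Eq.le ?_).trans ((hv _ hgreen).trans (sum_green_mul_degree_le hn o v))
    ring
  calc (t : ℝ) = t * (1 / ((n : ℝ) + 1) * (1 / ((n : ℝ) + 1)) ^ 2 /
          (4096 * Real.log (n + 1) ^ 2)) * ((n + 1) ^ 3 * (4096 * Real.log (n + 1) ^ 2)) := by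
        field_simp
    _ ≤ t * (tent n o v.2 * (1 / ((n : ℝ) + 1)) ^ 2 / (4096 * Real.log (n + 1) ^ 2)) *
          ((n + 1) ^ 3 * (4096 * Real.log (n + 1) ^ 2)) := by
        gcongr
        exact one_div_le_tent_coe o v.2
    _ ≤ 2 * ((n : ℝ) + 1) ^ 2 * ((n + 1) ^ 3 * (4096 * Real.log (n + 1) ^ 2)) := by gcongr
    _ = 8192 * (n + 1) ^ 5 * Real.log (n + 1) ^ 2 := by ring

theorem le_two_of_transientRun_one {t : ℕ} {c : Fin 1 × Fin 1 → ℕ}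
    (h : (gridSandpile 1).TransientRun t c) : t ≤ 2 := by
  obtain ⟨v, hv⟩ := h.exists_mul_le_sum_green
  have hpos := (gridSandpile 1).one_le_degree_mul_green_self v
  have hle := hv ((gridSandpile 1).green v v) fun u => by rw [Subsingleton.elim u v]
  rw [Fintype.sum_subsingleton _ v, degree_one, mul_comm _ ((2 : ℕ) : ℝ)] at hle
  rw [degree_one] at hpos
  exact_mod_cast le_of_mul_le_mul_right hle (pos_of_mul_pos_right (one_pos.trans_le hpos) (by simp))

theorem log_add_one_le_natLog_add_one (n : ℕ) : Real.log (n + 1) ≤ Nat.log 2 n + 1 := by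
  have hlt : (n : ℝ) + 1 ≤ 2 ^ (Nat.log 2 n + 1) := by
    exact_mod_cast Nat.lt_pow_succ_log_self Nat.one_lt_two n
  calc Real.log (n + 1) ≤ Real.log (2 ^ (Nat.log 2 n + 1)) := Real.log_le_log (by positivity) hlt
    _ = (Nat.log 2 n + 1) * Real.log 2 := by rw [Real.log_pow, Nat.cast_add_one]
    _ ≤ Nat.log 2 n + 1 :=
        mul_le_of_le_one_right (by positivity) (Real.log_two_lt_d9.le.trans (by norm_num))

end gridSandpile

theorem mainTheorem1_general {n : ℕ} (hn : 1 ≤ n) :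
    (gridSandpile n).tcl ≤ ((2 ^ 18 * n ^ 5 * (Nat.log 2 n + 1) ^ 2 : ℕ) : ℕ∞) := by
  refine iSup₂_le fun t ⟨c, hc⟩ => Nat.cast_le.2 ?_
  obtain rfl | hn₂ := hn.eq_or_lt
  · exact (gridSandpile.le_two_of_transientRun_one hc).trans (by norm_num)
  · have hlog : 0 ≤ Real.log (n + 1) := zero_le_one.trans (gridSandpile.one_le_log_add_one hn₂)
    have htwice : (n : ℝ) + 1 ≤ 2 * n := by norm_cast; omega
    suffices (t : ℝ) ≤ 2 ^ 18 * n ^ 5 * (Nat.log 2 n + 1) ^ 2 by exact_mod_cast this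
    calc (t : ℝ) ≤ 8192 * (n + 1) ^ 5 * Real.log (n + 1) ^ 2 :=
          gridSandpile.le_of_transientRun hn₂ hc
      _ ≤ 8192 * (2 * n) ^ 5 * (Nat.log 2 n + 1) ^ 2 := by
          gcongr
          exact gridSandpile.log_add_one_le_natLog_add_one n
      _ = 2 ^ 18 * n ^ 5 * (Nat.log 2 n + 1) ^ 2 := by ring

theorem mainTheorem1 :
    ∃ C : ℕ, ∀ n : ℕ, 1 ≤ n → (gridSandpile n).tcl ≤ ((C * n ^ 7 : ℕ) : ℕ∞) := by
  refine ⟨2 ^ 18, fun n hn => (mainTheorem1_general hn).trans (Nat.cast_le.2 ?_)⟩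
  have hlog : Nat.log 2 n + 1 ≤ n := Nat.log_lt_self 2 (Nat.ne_of_gt hn)
  exact (Nat.mul_le_mul_left _ (Nat.pow_le_pow_left hlog 2)).trans_eq (by ring)
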